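/- For a metric space $X$ and an integer $n\ge 0$, write $\operatorname{asdim}X\le n$ if for every $d>0$ there are $R$ and $n+1$ families $\mathcal U_0,\dots,\mathcal U_n$ of subsets of $X$ that together cover $X$, such that in each family every member has diameter at most $R$ and $d(x,y)>d$ whenever $x$ and $y$ lie in two different members; $\operatorname{asdim}X\in\{0,1,2,\dots\}\cup\{\infty\}$ is the least such $n$ ($\infty$ if there is none). For a finitely generated group $F$, regarded as discrete, $\operatorname{asdim}F$ is the asymptotic dimension of $F$ with any proper left invariant metric inducing the discrete topology (for example the word metric of a finite generating set); it does not depend on the choice of the metric. For an arbitrary group $G$, $\operatorname{asdim}G$ is the supremum of $\operatorname{asdim}F$ over the finitely generated subgroups $F$ of $G$. Let $\Gamma$ be a solvable group (not necessarily finitely generated or countable), with derived series $1=G_0\subset G_1\subset\dots\subset G_n=\Gamma$, $G_i=[G_{i+1},G_{i+1}]$, and let $$h(\Gamma)=\sum_{i=0}^{n-1}\dim_{\mathbf Q}\bigl((G_{i+1}/G_i)\otimes_{\mathbf Z}\mathbf Q\bigr)\in\{0,1,2,\dots\}\cup\{\infty\}$$ be its Hirsch length. Then $$\operatorname{asdim}\Gamma\le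 h(\Gamma).$$ -/

import Mathlib

/-- A family `𝒰` of subsets of `X` is `R`-bounded: every member has diameter at most `R`. -/
def IsBoundedFamily {X : Type*} [MetricSpace X] (R : ℝ) (𝒰 : Set (Set X)) : Prop :=
  ∀ U ∈ 𝒰, ∀ x ∈ U, ∀ y ∈ U, dist x y ≤ R

/-- A family `𝒰` of subsets of `X` is `d`-disjoint: points of two different members are
at distance greater than `d`. -/
def IsDisjointFamily {X : Type*} [MetricSpace X] (d : ℝ) (𝒰 : Set (Set X)) : Prop :=
  ∀ U ∈ 𝒰, ∀ V ∈ 𝒰, U ≠ V → ∀ x ∈ U, ∀ y ∈ V, d < dist x y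

/-- The metric space `X` has asymptotic dimension at most `n` (Gromov): for every `d > 0` there
are `R` and `n + 1` families of subsets, each `d`-disjoint and `R`-bounded, which together
cover `X`. -/
def AsdimLE (X : Type*) [MetricSpace X] (n : ℕ) : Prop :=
  ∀ d : ℝ, 0 < d → ∃ (R : ℝ) (𝒰 : Fin (n + 1) → Set (Set X)),
    (∀ i, IsDisjointFamily d (𝒰 i)) ∧ (∀ i, IsBoundedFamily R (𝒰 i)) ∧
      ∀ x : X, ∃ i, ∃ U ∈ 𝒰 i, x ∈ U

/-- The asymptotic dimension of a metric space: the least `n` with `AsdimLE X n`, and `⊤` if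
there is none. -/
noncomputable def metricAsdim (X : Type*) [MetricSpace X] : ℕ∞ :=
  ⨅ (n : ℕ) (_ : AsdimLE X n), (n : ℕ∞)

/-- `m` is a proper left invariant metric on the discrete group `Γ`. (Proper means that closed
balls are compact; together with discreteness, closed balls are finite.) -/
structure IsProperLeftInvariantMetric {Γ : Type*} [Group Γ] (m : MetricSpace Γ) : Prop where
  dist_mul_left : ∀ g x y : Γ, dist (g * x) (g * y) = dist x y
  properSpace : ProperSpace Γ
  discreteTopology : DiscreteTopology Γ

/-- The asymptotic dimension of a countable discrete group, in particular of a finitely generated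
one: that of the group with a proper left invariant metric, such as the word metric of a finite
generating set. Every countable group has such metrics, and any two of them are coarsely
equivalent, so that the supremum below is over equal values. -/
noncomputable def countableGroupAsdim (Γ : Type*) [Group Γ] : ℕ∞ :=
  ⨆ (m : MetricSpace Γ) (_ : IsProperLeftInvariantMetric m), metricAsdim Γ

/-- The asymptotic dimension of an arbitrary group: the supremum of the asymptotic dimensions of
its finitely generated subgroups. -/
noncomputable def groupAsdim (G : Type*) [Group G] : ℕ∞ :=
  ⨆ (F : Subgroup G) (_ : F.FG), countableGroupAsdim F

/-- The rational rank `dim_ℚ (A ⊗ ℚ)` of an abelian group `A`, with value `⊤` if the dimension is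
infinite. -/
noncomputable def rationalRank (A : Type*) [AddCommGroup A] : ℕ∞ :=
  Cardinal.toENat (Module.rank ℚ (TensorProduct ℤ ℚ A))

open Classical in
/-- The Hirsch length of a solvable group `Γ`: the sum of the rational ranks of the successive
quotients of its derived series `D 0 = Γ`, `D (i + 1) = ⁅D i, D i⁆`, down to the first trivial
term. The quotient `D i / D (i + 1) = D i / ⁅D i, D i⁆` is the abelianization of `D i`. -/
noncomputable def hirschLength (Γ : Type*) [Group Γ] [hΓ : Group.IsSolvable Γ] : ℕ∞ :=
  ∑ i ∈ Finset.range (Nat.find hΓ.solvable),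
    rationalRank (Additive (Abelianization (derivedSeries Γ i)))

/-!
The derived series is refined to a subnormal series whose factors are infinite cyclic or locally
finite; the number of infinite cyclic factors is the Hirsch length. A locally finite factor does
not raise the asymptotic dimension, an infinite cyclic one raises it by at most one.

**Coarse dimension of subsets.** The argument uses no metric. `CoarseDimLE X n` says that the
subset `X` of a group has asymptotic dimension at most `n` for the coarse structure in which the
controlled sets are those `E` with `{x⁻¹ * y | (x, y) ∈ E}` finite. It makes sense for uncountable
groups, passes along injective homomorphisms in both directions (`CoarseDimLE.map`,
`CoarseDimLE.comap`), and bounds `groupAsdim` (`groupAsdim_le_of_coarseDimLE`), because the balls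
of a proper metric on a discrete group are finite. If `π : G →* Q`, the preimage of a finite
subset of `Q` is coarsely equivalent to a part of `π.ker` (`CoarseDimLE.preimage_of_ker`). As a
decomposition at a given finite scale `S` need only be made on a subgroup containing `S`, locally
finite quotients follow at once (`CoarseDimLE.of_locallyFinite`).

**Infinite cyclic quotients** (`CoarseDimLE.succ_of_int`). Let `f : G → ℤ` be the projection.
Cut `ℤ` into periods of length `M`, and each period into strips that no step of the given scale
can jump over. Colour one period by a decomposition of its preimage into colours `0, …, n`, and
carry it to the other periods by left translation. In the strip number `2 * a` the colour `a` is
replaced by the new colour `n + 1`; hence a component of colour `a ≤ n` is caught between two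
consecutive such strips, while a component of colour `n + 1` stays in a single strip. A caught
component may still meet two periods, whose colourings are unrelated. So the last strip of each
period is coloured by a second decomposition, taken at a scale much larger than the bound on the
first one. A chain of fixed colour alternates between fine pieces and coarse pieces, and no fine
piece is long enough to connect two different coarse ones; so the chain meets at most one coarse
piece and is bounded.

**Abelian quotients** (`CoarseDimLE.add_rank`). If the abelian quotient has positive rank, it
contains an infinite cyclic subgroup; pass to its preimage and to the quotient by it, which has
rank one less. In rank `0` the quotient is torsion, hence locally finite.
-/

open scoped Pointwise

/-! ### Coarse dimension of subsets of a group -/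

/-- The subset `X` of the group `G` has asymptotic dimension at most `n`, for the left invariant
coarse structure generated by the finite subsets of `G`. For every finite scale `S` there are a
colouring `c` with the colours `0, …, n` and a labelling `l` by elements of `G`, such that points
of `X` of the same colour that differ by an element of `S` have the same label, and the label of a
point is within a finite distance `T` of it. Thus the sets of points of given colour and label are
`S`-disjoint within each colour and uniformly bounded. Labels need not lie in `X`, and the values
of `c` and `l` outside `X` are irrelevant, except that `c ≤ n`. -/
def CoarseDimLE {G : Type*} [Group G] (X : Set G) (n : ℕ) : Prop :=
  ∀ S : Set G, S.Finite → ∃ (T : Set G) (c : G → ℕ) (l : G → G), T.Finite ∧ (∀ x, c x ≤ n) ∧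
    (∀ x ∈ X, x⁻¹ * l x ∈ T) ∧
    ∀ x ∈ X, ∀ y ∈ X, c x = c y → x⁻¹ * y ∈ S → l x = l y

namespace CoarseDimLE

variable {G : Type*} [Group G] {n : ℕ}

theorem map {H : Type*} [Group H] {f : H →* G} (hf : Function.Injective f) {X : Set H}
    (h : CoarseDimLE X n) : CoarseDimLE (f '' X) n := by
  intro S hS
  obtain ⟨T, c, l, hT, hc, hl, hcl⟩ := h (f ⁻¹' S) (hS.preimage hf.injOn)
  have hinv : ∀ x, Function.invFun f (f x) = x := Function.leftInverse_invFun hf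
  refine ⟨f '' T, fun x => c (Function.invFun f x), fun x => f (l (Function.invFun f x)),
    hT.image f, fun x => hc _, ?_, ?_⟩
  · rintro _ ⟨x, hx, rfl⟩
    exact ⟨_, hl x hx, by simp [hinv]⟩
  · rintro _ ⟨x, hx, rfl⟩ _ ⟨y, hy, rfl⟩ hxy hS'
    simp only [hinv] at hxy ⊢
    rw [hcl x hx y hy hxy (by simpa using hS')]

/-- The labels of a decomposition of `X` need not lie in the range of `f`: each is replaced by a
point of `f ⁻¹' X` that carries it. -/
theorem comap {H : Type*} [Group H] {f : H →* G} (hf : Function.Injective f) {X : Set G}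
    (h : CoarseDimLE X n) : CoarseDimLE (f ⁻¹' X) n := by
  classical
  intro S hS
  obtain ⟨T, c, l, hT, hc, hl, hcl⟩ := h (f '' S) (hS.image f)
  let p : G → H := fun z => if hz : ∃ y, f y ∈ X ∧ l (f y) = z then hz.choose else 1
  have hp : ∀ x, f x ∈ X → f (p (l (f x))) ∈ X ∧ l (f (p (l (f x)))) = l (f x) := by
    intro x hx
    have hz : ∃ y, f y ∈ X ∧ l (f y) = l (f x) := ⟨x, hx, rfl⟩
    simp only [p, dif_pos hz]
    exact hz.choose_spec
  refine ⟨f ⁻¹' (T * T⁻¹), fun x => c (f x), fun x => p (l (f x)),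
    (hT.mul hT.inv).preimage hf.injOn, fun x => hc _, ?_, ?_⟩
  · intro x hx
    obtain ⟨h1, h2⟩ := hp x hx
    refine Set.mem_mul.2 ⟨_, hl _ hx, _, Set.inv_mem_inv.2 (hl _ h1), ?_⟩
    rw [h2]
    simp
  · intro x hx y hy hxy hS'
    have := hcl _ hx _ hy hxy ⟨_, hS', by simp⟩
    simp only [this]

/-- Right multiplication by the inverse of a set-theoretic section `σ` of `π` moves the preimage of
`B` into the kernel, by a bounded distance. -/
theorem preimage_of_ker {Q : Type*} [Group Q] {π : G →* Q}
    (h : CoarseDimLE (π.ker : Set G) n) {B : Set Q} (hB : B.Finite) :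
    CoarseDimLE (π ⁻¹' B) n := by
  intro S hS
  let σ : Q → G := Function.invFun π
  have hσ : ∀ x, π (σ (π x)) = π x := fun x => Function.invFun_eq ⟨x, rfl⟩
  have hker : ∀ x, x * (σ (π x))⁻¹ ∈ (π.ker : Set G) := by
    intro x
    simp [MonoidHom.mem_ker, hσ]
  obtain ⟨T, c, l, hT, hc, hl, hcl⟩ := h (σ '' B * S * (σ '' B)⁻¹)
    (((hB.image σ).mul hS).mul (hB.image σ).inv)
  refine ⟨(σ '' B)⁻¹ * T, fun x => c (x * (σ (π x))⁻¹), fun x => l (x * (σ (π x))⁻¹),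
    (hB.image σ).inv.mul hT, fun x => hc _, ?_, ?_⟩
  · intro x hx
    refine Set.mem_mul.2 ⟨_, Set.inv_mem_inv.2 ⟨_, hx, rfl⟩, _, hl _ (hker x), ?_⟩
    group
  · intro x hx y hy hxy hS'
    refine hcl _ (hker x) _ (hker y) hxy ?_
    refine Set.mem_mul.2 ⟨_, Set.mul_mem_mul ⟨_, hx, rfl⟩ hS', _,
      Set.inv_mem_inv.2 ⟨_, hy, rfl⟩, ?_⟩
    group

/-- Points in different left cosets of a subgroup containing the scale `S` never differ by an
element of `S`, so a decomposition of the subgroup can be translated to each of its cosets. -/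
theorem univ_of_subgroups
    (h : ∀ S : Set G, S.Finite → ∃ P : Subgroup G, S ⊆ P ∧ CoarseDimLE (P : Set G) n) :
    CoarseDimLE (Set.univ : Set G) n := by
  intro S hS
  obtain ⟨P, hSP, hP⟩ := h S hS
  obtain ⟨T, c, l, hT, hc, hl, hcl⟩ := hP S hS
  let r : G → G := fun x => (QuotientGroup.mk x : G ⧸ P).out
  have hr : ∀ x, (r x)⁻¹ * x ∈ P := fun x =>
    QuotientGroup.eq.1 (Quotient.out_eq' (QuotientGroup.mk x : G ⧸ P))
  refine ⟨T, fun x => c ((r x)⁻¹ * x), fun x => r x * l ((r x)⁻¹ * x), hT, fun x => hc _, ?_, ?_⟩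
  · intro x _
    convert hl _ (hr x) using 1
    group
  · intro x _ y _ hxy hS'
    have hrr : r x = r y := by
      simp only [r]
      rw [QuotientGroup.eq.2 (hSP hS')]
    simp only [hrr] at hxy ⊢
    rw [hcl _ (hrr ▸ hr x) _ (hr y) hxy (by simpa [mul_assoc] using hS')]

/-! ### Extensions with locally finite or infinite cyclic quotient -/

theorem of_locallyFinite {Q : Type*} [Group Q] {π : G →* Q}
    (hQ : ∀ B : Set Q, B.Finite → Finite (Subgroup.closure B))
    (h : CoarseDimLE (π.ker : Set G) n) : CoarseDimLE (Set.univ : Set G) n := by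
  refine univ_of_subgroups fun S hS => ⟨(Subgroup.closure (π '' S)).comap π, ?_, ?_⟩
  · exact fun s hs => Subgroup.subset_closure ⟨s, hs, rfl⟩
  · have := hQ _ (hS.image π)
    exact h.preimage_of_ker (Set.toFinite (Subgroup.closure (π '' S) : Set Q))

/-- Two integers at distance at most `e` whose residues lie in an interval `[p, q)` leaving a gap of
length at least `e` in the period `M` belong to the same period. -/
theorem _root_.Int.ediv_eq_of_abs_sub_le {M e x y p q : ℤ} (hM : 0 < M) (hpq : q + e ≤ M + p)
    (hxy : |x - y| ≤ e) (hx : p ≤ x % M ∧ x % M < q) (hy : p ≤ y % M ∧ y % M < q) :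
    x / M = y / M := by
  have h1 := Int.emod_add_mul_ediv x M
  have h2 := Int.emod_add_mul_ediv y M
  obtain ⟨h3, h4⟩ := abs_le.1 hxy
  rcases lt_trichotomy (x / M) (y / M) with h | h | h
  · linarith [mul_le_mul_of_nonneg_left (Int.add_one_le_iff.2 h) hM.le]
  · exact h
  · linarith [mul_le_mul_of_nonneg_left (Int.add_one_le_iff.2 h) hM.le]

/-- A group that maps onto `ℤ` has dimension at most one more than the preimages of the bounded
intervals. -/
theorem succ_of_int {G : Type*} [Group G] {n : ℕ} (φ : G →* Multiplicative ℤ) (t : G)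
    (ht : φ t = Multiplicative.ofAdd 1)
    (h : ∀ M : ℤ, CoarseDimLE {x : G | 0 ≤ (φ x).toAdd ∧ (φ x).toAdd < M} n) :
    CoarseDimLE (Set.univ : Set G) (n + 1) := by
  classical
  intro S hS
  let f : G → ℤ := fun x => (φ x).toAdd
  have fmul : ∀ x y, f (x * y) = f x + f y := fun x y => by simp [f]
  have finv : ∀ x, f x⁻¹ = - f x := fun x => by simp [f]
  have ft : ∀ k : ℤ, f (t ^ k) = k := fun k => by simp [f, ht]
  obtain ⟨e, he1, he⟩ : ∃ e : ℤ, 1 ≤ e ∧ ∀ s ∈ S, |f s| ≤ e := by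
    obtain ⟨e, he⟩ := (hS.image fun s => |f s|).bddAbove
    exact ⟨max e 1, le_max_right _ _, fun s hs => (he ⟨s, hs, rfl⟩).trans (le_max_left _ _)⟩
  have hadj : ∀ x y, x⁻¹ * y ∈ S → |f x - f y| ≤ e := fun x y hxy => by
    have := he _ hxy
    rw [fmul, finv] at this
    rw [abs_sub_comm]
    convert this using 2
    ring
  -- A period consists of the strips `0, …, 2 * n + 2`, each of width `e`.
  obtain ⟨M, hM⟩ : ∃ M : ℤ, M = e * (2 * n + 3) := ⟨_, rfl⟩
  have hM0 : 0 < M := by rw [hM]; positivity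
  -- A colouring of one period, spread over `G` by the translations by powers of `t ^ M`.
  have key : ∀ S' : Set G, S'.Finite → ∃ (T : Set G) (c : G → ℕ) (l : G → G), T.Finite ∧
      (∀ x, c x ≤ n) ∧ (∀ x, x⁻¹ * l x ∈ T) ∧
      ∀ x y, f x / M = f y / M → c x = c y → x⁻¹ * y ∈ S' → l x = l y := by
    intro S' hS'
    obtain ⟨T, c, l, hT, hc, hl, hcl⟩ := h M S' hS'
    let u : G → G := fun x => (t ^ (f x / M * M))⁻¹ * x
    have hu : ∀ x, u x ∈ {x : G | 0 ≤ (φ x).toAdd ∧ (φ x).toAdd < M} := by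
      intro x
      have h1 : f (u x) = f x % M := by
        simp only [u]
        rw [fmul, finv, ft, Int.emod_def]
        ring
      change 0 ≤ f (u x) ∧ f (u x) < M
      rw [h1]
      exact ⟨Int.emod_nonneg _ hM0.ne', Int.emod_lt_of_pos _ hM0⟩
    refine ⟨T, fun x => c (u x), fun x => t ^ (f x / M * M) * l (u x), hT, fun x => hc _, ?_, ?_⟩
    · intro x
      convert hl _ (hu x) using 1
      simp only [u]
      group
    · intro x y hq hxy hs
      change _ * l (u x) = _ * l (u y)
      rw [hcl _ (hu x) _ (hu y) hxy ?_, hq]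
      simp only [u, hq]
      convert hs using 1
      group
  obtain ⟨T₁, c₁, l₁, hT₁, hc₁, hl₁, hcl₁⟩ := key (S ∪ S⁻¹) (hS.union hS.inv)
  -- The scale of the second decomposition allows for a detour through one piece of the first.
  obtain ⟨T₂, c₂, l₂, hT₂, hc₂, hl₂, hcl₂⟩ :=
    key (S ∪ S⁻¹ ∪ (S ∪ S⁻¹)⁻¹ * (T₁ * T₁⁻¹) * (S ∪ S⁻¹))
      ((hS.union hS.inv).union (((hS.union hS.inv).inv.mul (hT₁.mul hT₁.inv)).mul
        (hS.union hS.inv)))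
  let coarse : G → Prop := fun x => (2 * n + 2) * e ≤ f x % M
  let cut : G → Prop := fun x => 2 * c₁ x * e ≤ f x % M ∧ f x % M < (2 * c₁ x + 1) * e
  let c : G → ℕ := fun x => if coarse x then c₂ x else if cut x then n + 1 else c₁ x
  -- For a point of colour `a`, `b x a` numbers the block between successive cuts of colour `a`.
  let b : G → ℕ → ℤ := fun x a => (f x - 2 * a * e) / M
  -- `E x w`: the fine piece of `x` touches the coarse point `w` of its colour and its block.
  let E : G → G → Prop := fun x w =>
    coarse w ∧ c₂ w = c₁ x ∧ f w / M = b x (c₁ x) ∧ ∃ y, l₁ y = l₁ x ∧ y⁻¹ * w ∈ S ∪ S⁻¹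
  let l : G → G := fun x => if coarse x then l₂ x else if cut x then l₁ x else
    if hx : ∃ w, E x w then l₂ hx.choose else l₁ x
  have hc_coarse : ∀ x, coarse x → c x = c₂ x := fun x hx => if_pos hx
  have hc_cut : ∀ x, ¬ coarse x → cut x → c x = n + 1 := fun x hx hx' => by
    simp only [c, if_neg hx, if_pos hx']
  have hc_fine : ∀ x, ¬ coarse x → ¬ cut x → c x = c₁ x := fun x hx hx' => by
    simp only [c, if_neg hx, if_neg hx']
  have hcast : ∀ a : ℕ, a ≤ n → (a : ℤ) * e ≤ n * e := fun a ha =>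
    mul_le_mul_of_nonneg_right (by exact_mod_cast ha) (by linarith)
  have hmod : ∀ x, 0 ≤ f x % M ∧ f x % M < M := fun x =>
    ⟨Int.emod_nonneg _ hM0.ne', Int.emod_lt_of_pos _ hM0⟩
  -- Points of colour at most `n` avoid the strip where this colour is cut.
  have havoid : ∀ x, c x ≤ n → e ≤ (f x - 2 * c x * e) % M := by
    intro x hx
    have hcx := hcast _ hx
    have hx1 := hmod x
    have hlow : f x % M < 2 * c x * e ∨ (2 * c x + 1) * e ≤ f x % M := by
      by_cases h1 : coarse x
      · right
        have : (2 * n + 2) * e ≤ f x % M := h1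
        linarith
      · by_cases h2 : cut x
        · have := hc_cut x h1 h2
          omega
        · rw [hc_fine x h1 h2]
          by_contra! h3
          exact h2 h3
    have hrw : (f x - 2 * c x * e) % M = (f x % M - 2 * c x * e) % M := by
      rw [Int.emod_sub_emod]
    rw [hrw]
    -- before the cut the point belongs to the block that starts in the previous period
    rcases hlow with h1 | h1
    · rw [← Int.add_emod_right, Int.emod_eq_of_lt] <;> nlinarith
    · rw [Int.emod_eq_of_lt] <;> nlinarith
  have hb : ∀ x y, x⁻¹ * y ∈ S → c x = c y → c x ≤ n → b x (c x) = b y (c x) := by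
    intro x y hs hxy hx
    have h1 := havoid x hx
    have h2 := havoid y (hxy ▸ hx)
    rw [← hxy] at h2
    refine Int.ediv_eq_of_abs_sub_le (e := e) (p := e) (q := M) hM0 le_rfl ?_
      ⟨h1, Int.emod_lt_of_pos _ hM0⟩ ⟨h2, Int.emod_lt_of_pos _ hM0⟩
    rw [sub_sub_sub_cancel_right]
    exact hadj x y hs
  have hb_coarse : ∀ x, coarse x → b x (c x) = f x / M := by
    intro x hx
    have h1 := hcast _ (hc_coarse x hx ▸ hc₂ x)
    have h2 : (2 * n + 2) * e ≤ f x % M := hx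
    have h3 := Int.emod_add_mul_ediv (f x) M
    have h4 := hmod x
    have h5 : (0 : ℤ) ≤ c x * e := by positivity
    simp only [b]
    rw [Int.ediv_eq_iff_of_pos hM0]
    constructor <;> nlinarith
  -- Points outside the coarse strip that are adjacent lie in the same period.
  have hq : ∀ x y, x⁻¹ * y ∈ S → ¬ coarse x → ¬ coarse y → f x / M = f y / M := by
    intro x y hs hx hy
    have h1 : f x % M < (2 * n + 2) * e := not_le.1 hx
    have h2 : f y % M < (2 * n + 2) * e := not_le.1 hy
    exact Int.ediv_eq_of_abs_sub_le (p := 0) hM0 (by linarith) (hadj x y hs)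
      ⟨(hmod x).1, h1⟩ ⟨(hmod y).1, h2⟩
  -- All coarse points that a fine piece touches have the same label.
  have hE : ∀ x w w', E x w → E x w' → l₂ w = l₂ w' := by
    rintro x w w' ⟨-, h1, h2, y, h3, h4⟩ ⟨-, h1', h2', y', h3', h4'⟩
    refine hcl₂ w w' (h2.trans h2'.symm) (h1.trans h1'.symm) (Or.inr ?_)
    refine Set.mem_mul.2 ⟨_, Set.mul_mem_mul (Set.inv_mem_inv.2 h4)
      (Set.mul_mem_mul (hl₁ y) (Set.inv_mem_inv.2 (hl₁ y'))), _, h4', ?_⟩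
    rw [h3, h3']
    group
  have hlE : ∀ x w, ¬ coarse x → ¬ cut x → E x w → l x = l₂ w := by
    intro x w h1 h2 h3
    have hx : ∃ w, E x w := ⟨w, h3⟩
    simp only [l, if_neg h1, if_neg h2, dif_pos hx]
    exact hE _ _ _ hx.choose_spec h3
  -- A fine point adjacent to a coarse one of the same colour takes its label.
  have hmix : ∀ x y, (x⁻¹ * y ∈ S ∨ y⁻¹ * x ∈ S) → c x = c y → ¬ coarse x → coarse y →
      l x = l y := by
    intro x y hs hxy hx hy
    have hyn : c y ≤ n := hc_coarse y hy ▸ hc₂ y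
    have hx' : ¬ cut x := fun h => by
      have := hc_cut x hx h
      omega
    have hxc := hc_fine x hx hx'
    have hbxy : b x (c x) = b y (c y) := by
      rcases hs with hs | hs
      · rw [hb x y hs hxy (hxy ▸ hyn), hxy]
      · rw [hb y x hs hxy.symm hyn, hxy]
    have : E x y := by
      refine ⟨hy, ?_, ?_, x, rfl, ?_⟩
      · rw [← hxc, hxy, hc_coarse y hy]
      · rw [← hxc, hbxy, hb_coarse y hy]
      · exact hs.imp id fun h => by simpa using h
    rw [hlE x y hx hx' this]
    simp only [l, if_pos hy]
  refine ⟨T₁ ∪ T₂ ∪ T₁ * T₁⁻¹ * (S ∪ S⁻¹) * T₂, c, l,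
    (hT₁.union hT₂).union (((hT₁.mul hT₁.inv).mul (hS.union hS.inv)).mul hT₂), ?_, ?_, ?_⟩
  · intro x
    simp only [c]
    split_ifs
    · exact (hc₂ x).trans n.le_succ
    · exact le_rfl
    · exact (hc₁ x).trans n.le_succ
  · intro x _
    by_cases h1 : coarse x
    · simp only [l, if_pos h1]
      exact Or.inl (Or.inr (hl₂ x))
    by_cases h2 : cut x
    · simp only [l, if_neg h1, if_pos h2]
      exact Or.inl (Or.inl (hl₁ x))
    by_cases h3 : ∃ w, E x w
    · obtain ⟨w, hw⟩ := h3
      rw [hlE x w h1 h2 hw]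
      obtain ⟨-, -, -, y, h4, h5⟩ := hw
      refine Or.inr (Set.mem_mul.2 ⟨_, Set.mul_mem_mul (Set.mul_mem_mul (hl₁ x)
        (Set.inv_mem_inv.2 (hl₁ y))) h5, _, hl₂ w, ?_⟩)
      rw [h4]
      group
    · simp only [l, if_neg h1, if_neg h2, dif_neg h3]
      exact Or.inl (Or.inl (hl₁ x))
  · intro x _ y _ hxy hs
    by_cases hx : coarse x <;> by_cases hy : coarse y
    · simp only [l, if_pos hx, if_pos hy]
      refine hcl₂ x y ?_ ?_ (Or.inl (Or.inl hs))
      · rw [← hb_coarse x hx, ← hb_coarse y hy,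
          hb x y hs hxy (hc_coarse x hx ▸ hc₂ x), hxy]
      · rw [← hc_coarse x hx, ← hc_coarse y hy, hxy]
    · exact (hmix y x (Or.inr hs) hxy.symm hy hx).symm
    · exact hmix x y (Or.inl hs) hxy hx hy
    have hqxy := hq x y hs hx hy
    by_cases hx' : cut x <;> by_cases hy' : cut y
    · simp only [l, if_neg hx, if_neg hy, if_pos hx', if_pos hy']
      refine hcl₁ x y hqxy ?_ (Or.inl hs)
      -- distinct strips of a period are more than `e` apart
      have h1 := Int.emod_add_mul_ediv (f x) M
      have h2 := Int.emod_add_mul_ediv (f y) M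
      rw [hqxy] at h1
      have h3 := abs_le.1 (hadj x y hs)
      obtain ⟨h4, h5⟩ := hx'
      obtain ⟨h6, h7⟩ := hy'
      rcases lt_trichotomy (c₁ x) (c₁ y) with h | h | h
      · have : ((c₁ x : ℤ) + 1) * e ≤ c₁ y * e :=
          mul_le_mul_of_nonneg_right (by exact_mod_cast h) (by linarith)
        linarith
      · exact h
      · have : ((c₁ y : ℤ) + 1) * e ≤ c₁ x * e :=
          mul_le_mul_of_nonneg_right (by exact_mod_cast h) (by linarith)
        linarith
    · have h1 := hc_cut x hx hx'
      have h2 := hc_fine y hy hy'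
      have h3 := hc₁ y
      omega
    · have h1 := hc_cut y hy hy'
      have h2 := hc_fine x hx hx'
      have h3 := hc₁ x
      omega
    · have h1 := hc_fine x hx hx'
      have h2 := hc_fine y hy hy'
      have h12 : c₁ x = c₁ y := by rw [← h1, ← h2, hxy]
      have h3 : l₁ x = l₁ y := hcl₁ x y hqxy h12 (Or.inl hs)
      have h4 : b x (c₁ x) = b y (c₁ x) := by
        have := hb x y hs hxy (h1 ▸ hc₁ x)
        rwa [h1] at this
      have h5 : E x = E y := by
        funext w
        simp only [E, ← h12, h3, h4]
      simp only [l, if_neg hx, if_neg hy, if_neg hx', if_neg hy', h3, h5]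

theorem of_ker_int {G : Type*} [Group G] {n : ℕ} (φ : G →* Multiplicative ℤ)
    (hφ : Function.Surjective φ) (h : CoarseDimLE (φ.ker : Set G) n) :
    CoarseDimLE (Set.univ : Set G) (n + 1) := by
  obtain ⟨t, ht⟩ := hφ (Multiplicative.ofAdd 1)
  refine succ_of_int φ t ht fun M => h.preimage_of_ker
    (B := Multiplicative.toAdd ⁻¹' Set.Ico 0 M) ?_
  exact (Set.finite_Ico (0 : ℤ) M).preimage Multiplicative.toAdd.injective.injOn

/-! ### Extensions with abelian quotient -/

/-- The rank is that over `ℤ`, the maximal number of linearly independent elements. -/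
theorem add_rank {G : Type*} [Group G] (r : ℕ) : ∀ {B : Type*} [AddCommGroup B] {m : ℕ}
    (π : G →* Multiplicative B), Function.Surjective π → Module.rank ℤ B = r →
    CoarseDimLE (π.ker : Set G) m → CoarseDimLE (Set.univ : Set G) (m + r) := by
  induction r with
  | zero =>
    intro B _ m π _ hr h
    refine of_locallyFinite (fun S hS => ?_) h
    rw [Nat.cast_zero, rank_eq_zero_iff] at hr
    have := hS.to_subtype
    have : Group.FG (Subgroup.closure S) := inferInstance
    refine CommGroup.finite_of_fg_isMulTorsion _ fun x => ?_
    obtain ⟨a, ha, hax⟩ := hr x.1.toAdd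
    refine isOfFinOrder_iff_zpow_eq_one.2 ⟨a, ha, ?_⟩
    apply Subtype.ext
    exact Multiplicative.toAdd.injective (by simpa using hax)
  | succ r ih =>
    intro B _ m π hπ hr h
    obtain ⟨b, hb⟩ : ∃ b : B, ∀ a : ℤ, a • b = 0 → a = 0 := by
      by_contra! hcon
      have : Module.rank ℤ B = 0 :=
        rank_eq_zero_iff.2 fun x => (hcon x).imp fun a ha => ⟨ha.2, ha.1⟩
      rw [this] at hr
      exact absurd hr (by exact_mod_cast (Nat.succ_ne_zero r).symm)
    -- `C` is the infinite cyclic subgroup generated by `b`, and `π'` the projection to `B ⧸ C`.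
    let g : ℤ →ₗ[ℤ] B := LinearMap.toSpanSingleton ℤ B b
    have hg : Function.Injective g :=
      (injective_iff_map_eq_zero g).2 fun a ha => hb a (by simpa [g] using ha)
    let C := LinearMap.range g
    let E : ℤ ≃ₗ[ℤ] C := LinearEquiv.ofInjective g hg
    have hC : Module.rank ℤ C = 1 := by
      have := E.lift_rank_eq
      simpa using this.symm
    have hrank : Module.rank ℤ (B ⧸ C) = r := by
      have := rank_quotient_add_rank_of_isDomain C
      rw [hC, hr, Nat.cast_succ] at this
      exact Cardinal.add_one_inj.1 this
    let π' : G →* Multiplicative (B ⧸ C) :=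
      (AddMonoidHom.toMultiplicative C.mkQ.toAddMonoidHom).comp π
    have hmem : ∀ x : π'.ker, (π x).toAdd ∈ C := fun x => by
      have h1 : C.mkQ (π x).toAdd = 0 := x.2
      simpa using h1
    -- `π'.ker` is an extension of `C ≃ ℤ` by `π.ker`.
    let φ : π'.ker →* Multiplicative ℤ := MonoidHom.mk'
      (fun x => Multiplicative.ofAdd (E.symm ⟨(π x).toAdd, hmem x⟩)) fun x y => by
        rw [← ofAdd_add, ← map_add]
        congr 2
        apply Subtype.ext
        simp
    have hφ : Function.Surjective φ := by
      intro k
      obtain ⟨x, hx⟩ := hπ (Multiplicative.ofAdd (g k.toAdd))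
      have hx' : x ∈ π'.ker := by
        change C.mkQ (π x).toAdd = 0
        rw [hx]
        simp [C]
      refine ⟨⟨x, hx'⟩, ?_⟩
      apply Multiplicative.toAdd.injective
      change E.symm _ = _
      rw [LinearEquiv.symm_apply_eq]
      apply Subtype.ext
      rw [LinearEquiv.ofInjective_apply]
      simp [hx]
    have hker : (φ.ker : Set π'.ker) = π'.ker.subtype ⁻¹' (π.ker : Set G) := by
      ext x
      change E.symm ⟨(π x).toAdd, hmem x⟩ = 0 ↔ (π x).toAdd = 0
      rw [LinearEquiv.map_eq_zero_iff, Submodule.mk_eq_zero]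
    have hstep := of_ker_int φ hφ (hker ▸ h.comap Subtype.val_injective)
    have hπ' : CoarseDimLE (π'.ker : Set G) (m + 1) := by
      have := hstep.map (f := π'.ker.subtype) Subtype.val_injective
      rwa [Set.image_univ, Subgroup.coe_subtype, Subtype.range_coe_subtype] at this
    have := ih π' ((Submodule.mkQ_surjective C).comp hπ) hrank hπ'
    rwa [add_right_comm] at this

end CoarseDimLE

theorem rationalRank_eq (A : Type*) [AddCommGroup A] :
    rationalRank A = Cardinal.toENat (Module.rank ℤ A) := by
  have := (TensorProduct.isBaseChange ℤ A ℚ).rank_eq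
  rw [rationalRank, this]

/-! ### From coarse dimension to asymptotic dimension -/

/-- A ball around `1` of a proper metric is finite in a discrete group, so it can serve as a scale. -/
theorem AsdimLE.of_coarseDimLE {G : Type*} [Group G] {n : ℕ}
    (h : CoarseDimLE (Set.univ : Set G) n) {F : Subgroup G} {m : MetricSpace F}
    (hm : IsProperLeftInvariantMetric m) : AsdimLE F n := by
  intro d _
  have := hm.properSpace
  have := hm.discreteTopology
  have hball : (Metric.closedBall (1 : F) d).Finite :=
    (isCompact_closedBall (1 : F) d).finite_of_discrete
  have hdist : ∀ x y : F, dist x y = dist (1 : F) (x⁻¹ * y) := fun x y => by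
    rw [← hm.dist_mul_left x⁻¹ x y, inv_mul_cancel]
  obtain ⟨T, c, l, hT, hc, hl, hcl⟩ := h _ (hball.image Subtype.val)
  obtain ⟨R, hR⟩ := (((hT.mul hT.inv).preimage (f := ((↑) : F → G))
    Subtype.val_injective.injOn).image fun g => dist (1 : F) g).bddAbove
  refine ⟨R, fun i => Set.range fun z : G => {x : F | c x = i ∧ l x = z}, ?_, ?_, ?_⟩
  · rintro i _ ⟨z, rfl⟩ _ ⟨z', rfl⟩ hne x ⟨hx, hx'⟩ y ⟨hy, hy'⟩
    by_contra! hle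
    refine hne ?_
    have : l x = l y := by
      refine hcl _ trivial _ trivial (hx.trans hy.symm) ⟨x⁻¹ * y, ?_, rfl⟩
      rw [Metric.mem_closedBall, dist_comm, ← hdist]
      exact hle
    rw [← hx', ← hy', this]
  · rintro i _ ⟨z, rfl⟩ x ⟨-, hx⟩ y ⟨-, hy⟩
    rw [hdist]
    refine hR ⟨_, ?_, rfl⟩
    refine Set.mem_mul.2 ⟨_, hl x trivial, _, Set.inv_mem_inv.2 (hl y trivial), ?_⟩
    rw [hx, hy]
    simp
  · intro x
    exact ⟨⟨c x, Nat.lt_succ_of_le (hc x)⟩, _, ⟨l x, rfl⟩, rfl, rfl⟩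

theorem groupAsdim_le_of_coarseDimLE {G : Type*} [Group G] {n : ℕ}
    (h : CoarseDimLE (Set.univ : Set G) n) : groupAsdim G ≤ n :=
  iSup₂_le fun _ _ => iSup₂_le fun _ hm => iInf₂_le n (AsdimLE.of_coarseDimLE h hm)

/-! ### The derived series -/

theorem coarseDimLE_derivedSeries {G : Type*} [Group G] {i m r : ℕ}
    (hr : rationalRank (Additive (Abelianization (derivedSeries G i))) = r)
    (h : CoarseDimLE (derivedSeries G (i + 1) : Set G) m) :
    CoarseDimLE (derivedSeries G i : Set G) (m + r) := by
  rw [rationalRank_eq, Cardinal.toENat_eq_natCast] at hr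
  have h1 : CoarseDimLE (commutator (derivedSeries G i) : Set (derivedSeries G i)) m := by
    have := h.comap (f := (derivedSeries G i).subtype) Subtype.val_injective
    convert this using 1
    rw [← Subgroup.coe_comap, SetLike.coe_set_eq, derivedSeries_succ]
    rw [← Subgroup.map_subtype_commutator,
      Subgroup.comap_map_eq_self_of_injective Subtype.val_injective]
  have h2 := CoarseDimLE.add_rank r (B := Additive (Abelianization (derivedSeries G i)))
    (m := m) (Abelianization.of : derivedSeries G i →* Abelianization (derivedSeries G i))
    (QuotientGroup.mk_surjective) hr (by rwa [← Abelianization.ker_of] at h1)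
  have h3 := h2.map (f := (derivedSeries G i).subtype) Subtype.val_injective
  convert h3 using 1
  simp

theorem groupAsdim_le_sum_rationalRank {Γ : Type*} [Group Γ] {N : ℕ}
    (hN : derivedSeries Γ N = ⊥) :
    groupAsdim Γ ≤
      ∑ i ∈ Finset.range N, rationalRank (Additive (Abelianization (derivedSeries Γ i))) := by
  by_cases htop : ∃ i ∈ Finset.range N,
      rationalRank (Additive (Abelianization (derivedSeries Γ i))) = ⊤
  · obtain ⟨i, hi, hi'⟩ := htop
    refine le_top.trans (hi'.ge.trans ?_)
    exact Finset.single_le_sum (f := fun i => rationalRank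
      (Additive (Abelianization (derivedSeries Γ i)))) (fun _ _ => zero_le) hi
  push Not at htop
  have hr : ∀ i, ∃ r : ℕ,
      i < N → rationalRank (Additive (Abelianization (derivedSeries Γ i))) = r := by
    intro i
    by_cases hi : i < N
    · obtain ⟨r, hr⟩ := ENat.ne_top_iff_exists.1 (htop i (Finset.mem_range.2 hi))
      exact ⟨r, fun _ => hr.symm⟩
    · exact ⟨0, fun h => absurd h hi⟩
  choose r hr using hr
  rw [Finset.sum_congr rfl fun i hi => hr i (Finset.mem_range.1 hi), ← Nat.cast_sum]
  -- ascend from the trivial term of the derived series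
  have main : ∀ k ≤ N, CoarseDimLE (derivedSeries Γ (N - k) : Set Γ)
      (∑ i ∈ Finset.Ico (N - k) N, r i) := by
    intro k
    induction k with
    | zero =>
      intro _ S _
      refine ⟨{1}, fun _ => 0, fun _ => 1, Set.finite_singleton _, by simp, ?_, by simp⟩
      simp [hN]
    | succ k ih =>
      intro hk
      have h1 : N - k = N - (k + 1) + 1 := by omega
      have h2 := ih (by omega)
      rw [h1] at h2
      have h3 := coarseDimLE_derivedSeries (hr (N - (k + 1)) (by omega)) h2
      rwa [Finset.sum_eq_sum_Ico_succ_bot (by omega), add_comm (r _)]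
  have := main N le_rfl
  rw [Nat.sub_self, Nat.Ico_zero_eq_range, derivedSeries_zero, Subgroup.coe_top] at this
  exact groupAsdim_le_of_coarseDimLE this

theorem theorem3p4 (Γ : Type*) [Group Γ] [Group.IsSolvable Γ] :
    groupAsdim Γ ≤ hirschLength Γ := by
  classical
  exact groupAsdim_le_sum_rationalRank (Nat.find_spec (Group.IsSolvable.solvable (G := Γ)))
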